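/- An approach space is a set $X$ with a function $\delta:PX\times X\to[0,\infty]$ such that, for all $A,B\subseteq X$, $x\in X$ and $\varepsilon\in[0,\infty]$: $\delta(\{x\},x)=0$; $\delta(\varnothing,x)=\infty$; $\delta(A\cup B,x)=\min\{\delta(A,x),\delta(B,x)\}$; and $\delta(\{y\in X\mid\delta(A,y)\le\varepsilon\},x)+\varepsilon\ge\delta(A,x)$. A map $f:(X,\delta)\to(Y,\delta')$ is a contraction if $\delta(A,x)\ge\delta'(f(A),f(x))$ for all $A\subseteq X$ and $x\in X$. Let $\mathbf{App}$ be the category of approach spaces and contractions. An approach space $X$ is exponentiable if the cartesian product functor $(-)\times X:\mathbf{App}\to\mathbf{App}$ has a right adjoint. Write $UX$ for the set of ultrafilters on $X$ and let $m_X:UUX\to UX$, $m_X(\mathfrak X)=\{A\subseteq X\mid\{\mathfrak a\in UX\mid A\in\mathfrak a\}\in\mathfrak X\}$. The ultrafilter convergence of an approach space $(X,\delta)$ is $a:UX\times X\to[0,\infty]$, $a(\mathfrak x,x)=\sup_{A\in\mathfrak x}\delta(A,x)$, and for $\mathfrak X\in UUX$, $\mathfrak x\in UX$ put $$\overline U a(\mathfrak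 X,\mathfrak x)=\sup_{\mathcal A\in\mathfrak X,\,B\in\mathfrak x}\ \inf_{\mathfrak a\in\mathcal A,\,x\in B}a(\mathfrak a,x).$$ Write $u\vee v$ for the maximum of $u$ and $v$. **Theorem.** Let $X$ be an approach space with ultrafilter convergence $a$. Then $X$ is exponentiable in $\mathbf{App}$ if and only if, for all $\mathfrak X\in UUX$, $x_0\in X$ and $u,v\in[0,\infty]$, $$(u+v)\vee a(m_X(\mathfrak X),x_0)\ \ge\ \inf_{\mathfrak x\in UX}\Big(\big(u\vee a(\mathfrak x,x_0)\big)+\big(v\vee\overline U a(\mathfrak X,\mathfrak x)\big)\Big).$$ -/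

import Mathlib

open CategoryTheory Limits
open scoped ENNReal

universe w

/-- An approach space: a set `X` with an approach distance `δ : PX × X → [0,∞]`. -/
class ApproachSpace (X : Type w) where
  /-- the approach distance -/
  δ : Set X → X → ℝ≥0∞
  δ_singleton : ∀ x, δ {x} x = 0
  δ_empty : ∀ x, δ ∅ x = ∞
  δ_union : ∀ A B x, δ (A ∪ B) x = min (δ A x) (δ B x)
  δ_enlarge : ∀ (A : Set X) (x : X) (ε : ℝ≥0∞), δ A x ≤ δ {y | δ A y ≤ ε} x + ε

namespace ApproachSpace

/-- A map `f` is a contraction if `δ (A, x) ≥ δ' (f(A), f(x))` for all `A`, `x`. -/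
def IsContraction {X Y : Type w} [ApproachSpace X] [ApproachSpace Y] (f : X → Y) : Prop :=
  ∀ (A : Set X) (x : X), δ (f '' A) (f x) ≤ δ A x

/-- The ultrafilter convergence of an approach space: `a (𝔵, x) = sup_{A ∈ 𝔵} δ (A, x)`. -/
noncomputable def conv {X : Type w} [ApproachSpace X] (𝔵 : Ultrafilter X) (x : X) : ℝ≥0∞ :=
  ⨆ A ∈ 𝔵, δ A x

/-- The extension of the ultrafilter functor to numerical relations:
`Ū r (𝔵, 𝔶) = sup_{A ∈ 𝔵, B ∈ 𝔶} inf_{x ∈ A, y ∈ B} r (x, y)`. -/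
noncomputable def ultraExt {X Y : Type w} (r : X → Y → ℝ≥0∞)
    (𝔵 : Ultrafilter X) (𝔶 : Ultrafilter Y) : ℝ≥0∞ :=
  ⨆ A ∈ 𝔵, ⨆ B ∈ 𝔶, ⨅ x ∈ A, ⨅ y ∈ B, r x y

/-- The multiplication `m_X : UUX → UX` of the ultrafilter monad. -/
def ultraMul {X : Type w} (𝔛 : Ultrafilter (Ultrafilter X)) : Ultrafilter X :=
  𝔛.bind id

theorem mem_ultraMul {X : Type w} {𝔛 : Ultrafilter (Ultrafilter X)} {A : Set X} :
    A ∈ ultraMul 𝔛 ↔ {𝔞 : Ultrafilter X | A ∈ 𝔞} ∈ 𝔛 :=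
  Iff.rfl

section Basic

variable {X Y Z : Type w} [ApproachSpace X] [ApproachSpace Y] [ApproachSpace Z]

theorem δ_mono {A B : Set X} (h : A ⊆ B) (x : X) : δ B x ≤ δ A x := by
  have := δ_union A B x
  rw [Set.union_eq_self_of_subset_left h] at this
  rw [this]
  exact min_le_left _ _

theorem δ_of_mem {A : Set X} {x : X} (h : x ∈ A) : δ A x = 0 :=
  le_antisymm ((δ_mono (Set.singleton_subset_iff.2 h) x).trans (δ_singleton x).le) bot_le

theorem le_δ_of_cover (F : Finset (Set X)) (A : Set X) (hA : A ⊆ ⋃ B ∈ F, B) (x : X) :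
    ⨅ B ∈ F, δ (A ∩ B) x ≤ δ A x := by
  classical
  induction F using Finset.induction_on generalizing A with
  | empty =>
    have : A = ∅ := by simpa using hA
    simp [this, δ_empty]
  | insert B F _ ih =>
    have h1 : A = (A ∩ B) ∪ (A ∩ ⋃ C ∈ F, C) := by
      rw [← Set.inter_union_distrib_left]
      refine (Set.inter_eq_left.2 ?_).symm
      simpa using hA
    conv_rhs => rw [h1, δ_union]
    rw [Finset.iInf_insert]
    refine le_min inf_le_left (inf_le_right.trans ?_)
    refine le_trans ?_ (ih _ Set.inter_subset_right)
    exact iInf₂_mono fun C _ =>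
      δ_mono (Set.inter_subset_inter_left _ Set.inter_subset_left) x

theorem isContraction_id : IsContraction (id : X → X) := fun A x => by simp

theorem IsContraction.comp {g : Y → Z} {f : X → Y} (hg : IsContraction g)
    (hf : IsContraction f) : IsContraction (g ∘ f) := fun A x => by
  rw [Set.image_comp]
  exact (hg _ _).trans (hf _ _)

/-- The product approach distance on `X × Y`: the supremum, over all finite covers of `A`, of
`min_B max (δ (π₁ B, x), δ (π₂ B, y))`, where `B` runs through the cover. That this is the
product in the category of approach spaces is shown in `AppCat.prodIsLimit`. -/
noncomputable def prodδ (A : Set (X × Y)) (p : X × Y) : ℝ≥0∞ :=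
  ⨆ (F : Finset (Set (X × Y))) (_ : A ⊆ ⋃ B ∈ F, B),
    ⨅ B ∈ F, max (δ (Prod.fst '' B) p.1) (δ (Prod.snd '' B) p.2)

theorem prodδ_mono {A A' : Set (X × Y)} (h : A ⊆ A') (p : X × Y) :
    prodδ A' p ≤ prodδ A p :=
  iSup_mono fun _ => iSup_le fun hF => le_iSup_of_le (h.trans hF) le_rfl

noncomputable instance prod : ApproachSpace (X × Y) where
  δ := prodδ
  δ_singleton p := by
    refine le_antisymm (iSup₂_le fun F hF => ?_) bot_le
    obtain ⟨B, hB, hp⟩ : ∃ B ∈ F, p ∈ B := by simpa using hF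
    refine (iInf₂_le B hB).trans ?_
    rw [δ_of_mem (Set.mem_image_of_mem _ hp), δ_of_mem (Set.mem_image_of_mem _ hp)]
    simp
  δ_empty p := by
    refine top_unique (le_iSup₂_of_le ∅ (by simp) (by simp))
  δ_union A A' p := by
    classical
    refine le_antisymm (le_min (prodδ_mono Set.subset_union_left p)
      (prodδ_mono Set.subset_union_right p)) ?_
    rw [prodδ, prodδ]
    rw [iSup₂_inf_eq]
    refine iSup₂_le fun F hF => ?_
    rw [inf_iSup₂_eq]
    refine iSup₂_le fun G hG => ?_
    refine le_iSup₂_of_le (F ∪ G) ?_ ?_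
    · rw [Finset.set_biUnion_union]
      exact Set.union_subset_union hF hG
    · rw [Finset.iInf_union]
  δ_enlarge A p ε := by
    classical
    refine iSup₂_le fun F hF => ?_
    let E : Set (X × Y) → Set (X × Y) := fun B =>
      {q | max (δ (Prod.fst '' B) q.1) (δ (Prod.snd '' B) q.2) ≤ ε}
    by_cases hε : ε = ∞
    · simp [hε]
    have hcov : {q | prodδ A q ≤ ε} ⊆ ⋃ B ∈ F.image E, B := by
      intro q hq
      have h1 : ⨅ B ∈ F, max (δ (Prod.fst '' B) q.1) (δ (Prod.snd '' B) q.2) ≤ ε :=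
        (le_iSup₂ (f := fun (F : Finset (Set (X × Y))) (_ : A ⊆ ⋃ B ∈ F, B) =>
          ⨅ B ∈ F, max (δ (Prod.fst '' B) q.1) (δ (Prod.snd '' B) q.2)) F hF).trans hq
      have hne : F.Nonempty := by
        rw [Finset.nonempty_iff_ne_empty]
        rintro rfl
        simp [hε] at h1
      rw [← Finset.inf_eq_iInf] at h1
      obtain ⟨B, hB, hBe⟩ := Finset.exists_mem_eq_inf F hne
        (fun B => max (δ (Prod.fst '' B) q.1) (δ (Prod.snd '' B) q.2))
      rw [hBe] at h1
      simp only [Finset.mem_image, Set.mem_iUnion]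
      exact ⟨E B, ⟨B, hB, rfl⟩, h1⟩
    refine le_trans ?_ (add_le_add_left (le_iSup₂_of_le (F.image E) hcov le_rfl) ε)
    rw [ENNReal.iInf_add]
    refine le_iInf fun C => ?_
    by_cases hC : C ∈ F.image E
    · obtain ⟨B, hB, rfl⟩ := Finset.mem_image.1 hC
      simp only [hC, iInf_pos]
      refine (iInf₂_le B hB).trans (max_le ?_ ?_)
      · refine (δ_enlarge _ _ ε).trans (add_le_add_left ((δ_mono ?_ _).trans (le_max_left _ _)) ε)
        rintro _ ⟨q, hq, rfl⟩
        exact (le_max_left (δ (Prod.fst '' B) q.1) (δ (Prod.snd '' B) q.2)).trans hq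
      · refine (δ_enlarge _ _ ε).trans (add_le_add_left ((δ_mono ?_ _).trans (le_max_right _ _)) ε)
        rintro _ ⟨q, hq, rfl⟩
        exact (le_max_right (δ (Prod.fst '' B) q.1) (δ (Prod.snd '' B) q.2)).trans hq
    · simp [hC]

theorem isContraction_fst : IsContraction (Prod.fst : X × Y → X) := fun A p =>
  le_iSup₂_of_le {A} (by simp) (by simp)

theorem isContraction_snd : IsContraction (Prod.snd : X × Y → Y) := fun A p =>
  le_iSup₂_of_le {A} (by simp) (by simp)

theorem IsContraction.prodMk {f : Z → X} {g : Z → Y} (hf : IsContraction f)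
    (hg : IsContraction g) : IsContraction (fun z => (f z, g z)) := fun A z => by
  classical
  refine iSup₂_le fun F hF => ?_
  let h : Z → X × Y := fun z => (f z, g z)
  have hcov : A ⊆ ⋃ C ∈ F.image (fun B => h ⁻¹' B), C := by
    intro a ha
    obtain ⟨B, hB, haB⟩ : ∃ B ∈ F, h a ∈ B := by simpa using hF (Set.mem_image_of_mem h ha)
    simp only [Finset.mem_image, Set.mem_iUnion]
    exact ⟨_, ⟨B, hB, rfl⟩, haB⟩
  refine le_trans ?_ (le_δ_of_cover _ A hcov z)
  refine le_iInf₂ fun C hC => ?_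
  obtain ⟨B, hB, rfl⟩ := Finset.mem_image.1 hC
  refine (iInf₂_le B hB).trans (max_le ?_ ?_)
  · refine (δ_mono ?_ _).trans (hf _ z)
    rintro _ ⟨c, hc, rfl⟩
    exact ⟨h c, hc.2, rfl⟩
  · refine (δ_mono ?_ _).trans (hg _ z)
    rintro _ ⟨c, hc, rfl⟩
    exact ⟨h c, hc.2, rfl⟩

end Basic

end ApproachSpace

open ApproachSpace

/-- The category of approach spaces and contractions: its objects. -/
structure AppCat where
  /-- bundle an approach space -/
  of ::
  /-- the underlying set -/
  carrier : Type w
  [str : ApproachSpace carrier]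

attribute [instance] AppCat.str

namespace AppCat

/-- The morphisms of the category of approach spaces: contractions. -/
@[ext]
structure Hom (X Y : AppCat.{w}) where
  /-- the underlying map -/
  toFun : X.carrier → Y.carrier
  contraction : IsContraction toFun

instance : Category AppCat.{w} where
  Hom := Hom
  id _ := ⟨id, isContraction_id⟩
  comp f g := ⟨g.toFun ∘ f.toFun, g.contraction.comp f.contraction⟩

@[ext]
theorem hom_ext {X Y : AppCat.{w}} {f g : X ⟶ Y} (h : ∀ x, f.toFun x = g.toFun x) : f = g :=
  Hom.ext (funext h)

/-- The cartesian product of two approach spaces. -/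
noncomputable def prod (Y X : AppCat.{w}) : AppCat.{w} := of (Y.carrier × X.carrier)

/-- The first projection. -/
noncomputable def fst (Y X : AppCat.{w}) : prod Y X ⟶ Y := ⟨Prod.fst, isContraction_fst⟩

/-- The second projection. -/
noncomputable def snd (Y X : AppCat.{w}) : prod Y X ⟶ X := ⟨Prod.snd, isContraction_snd⟩

/-- `prod Y X`, with its projections, is the categorical product of `Y` and `X`. -/
noncomputable def prodIsLimit (Y X : AppCat.{w}) : IsLimit (BinaryFan.mk (fst Y X) (snd Y X)) :=
  BinaryFan.isLimitMk
    (fun s => ⟨fun z => (s.fst.toFun z, s.snd.toFun z),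
      s.fst.contraction.prodMk s.snd.contraction⟩)
    (fun _ => rfl) (fun _ => rfl)
    (fun _ _ h₁ h₂ => hom_ext fun z => Prod.ext
      (congrFun (congrArg Hom.toFun h₁) z) (congrFun (congrArg Hom.toFun h₂) z))

/-- The functor `(-) × X : App ⥤ App`. -/
noncomputable def prodFunctor (X : AppCat.{w}) : AppCat.{w} ⥤ AppCat.{w} where
  obj Y := prod Y X
  map f := ⟨fun p => (f.toFun p.1, p.2),
    (f.contraction.comp isContraction_fst).prodMk isContraction_snd⟩

/-- `X` is exponentiable if the functor `(-) × X` has a right adjoint. -/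
def IsExponentiable (X : AppCat.{w}) : Prop := (prodFunctor X).IsLeftAdjoint

end AppCat

/-! Approach spaces are the same as reflexive, transitive ultrafilter convergences
(`exists_conv_le_δ`, `conv_ultraMul_le`, `conv_ofConv`). In these terms contractions and products
are computed pointwise (`isContraction_iff_conv`, `conv_prod`).

Sufficiency: the set of contractions from `X` to `Y` carries a smallest convergence `expConv` making
evaluation a contraction. Reflexivity is automatic; only transitivity can fail. The inequality gives
it (`expConv_ultraMul_le`): it splits a convergence of `ultraMul 𝔛` to a point through an
intermediate ultrafilter, and transitivity in `Y` recombines the two stages. Currying is then an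
adjunction.

Necessity: let `E` be the exponential of `[0,∞]` with distance `y - sup A`. Its points are the
contractions from `X` to `[0,∞]`, among them `δ {x}`, `v ⊔ conv 𝔞` and the right-hand infimum as a
function of `x₀`. Testing against one-point extensions of discrete sets bounds convergence in `E`:
the `δ {x}` converge along `𝔞` to `v ⊔ conv 𝔞` within `v`, and these converge along `𝔛` to the
infimum function within `u`. Transitivity in `E` gives `u + v` along `ultraMul 𝔛`. Evaluation is
zero on the pairs `(δ {x}, x)`, so its contractivity there is the inequality. -/

namespace ApproachSpace

/-! ### Lifting ultrafilters along maps and relations. -/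

section Ultrafilters

variable {S T X Y : Type*}

theorem ultrafilter_map_eq_of_le {f : S → T} {𝔰 : Ultrafilter S} {𝔱 : Ultrafilter T}
    (h : Filter.map f (𝔰 : Filter S) ≤ 𝔱) : 𝔰.map f = 𝔱 :=
  Ultrafilter.coe_le_coe.1 (by simpa using h)

/-- An ultrafilter on the codomain that meets the image of `Q` lifts to one containing `Q`. -/
theorem exists_ultrafilter_map_eq (f : S → T) (𝔱 : Ultrafilter T) {Q : Set S}
    (h : f '' Q ∈ 𝔱) : ∃ 𝔰 : Ultrafilter S, Q ∈ 𝔰 ∧ 𝔰.map f = 𝔱 := by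
  have hne : (Filter.comap f 𝔱 ⊓ Filter.principal Q).NeBot := by
    rw [Filter.inf_principal_neBot_iff]
    rintro U ⟨V, hV, hVU⟩
    obtain ⟨t, htV, s, hs, rfl⟩ := 𝔱.nonempty_of_mem (Filter.inter_mem hV h)
    exact ⟨s, hVU htV, hs⟩
  have hle := Ultrafilter.of_le (Filter.comap f 𝔱 ⊓ Filter.principal Q)
  refine ⟨Ultrafilter.of (Filter.comap f 𝔱 ⊓ Filter.principal Q), ?_,
    ultrafilter_map_eq_of_le ?_⟩
  · exact hle.trans inf_le_right (Filter.mem_principal_self Q)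
  · exact Filter.map_le_iff_le_comap.2 (hle.trans inf_le_left)

/-- The ultrafilter functor weakly preserves the pullback of `Prod.fst` along `f`. -/
theorem exists_ultrafilter_prod_lift (f : S → T) (𝔰 : Ultrafilter S) (𝔮 : Ultrafilter (T × X))
    (h : 𝔮.map Prod.fst = 𝔰.map f) :
    ∃ 𝔯 : Ultrafilter (S × X), 𝔯.map (Prod.map f id) = 𝔮 ∧ 𝔯.map Prod.fst = 𝔰 := by
  let 𝓕 : Filter (S × X) := Filter.comap Prod.fst 𝔰 ⊓ Filter.comap (Prod.map f id) 𝔮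
  have hne : 𝓕.NeBot := by
    rw [Filter.inf_neBot_iff]
    rintro U ⟨A, hA, hAU⟩ V ⟨Q, hQ, hQV⟩
    have h1 : f '' A ∈ 𝔮.map Prod.fst := by
      rw [h]
      exact Filter.image_mem_map hA
    obtain ⟨⟨t, x⟩, ⟨s, hs, hst⟩, hQ'⟩ := 𝔮.nonempty_of_mem (Filter.inter_mem h1 hQ)
    refine ⟨(s, x), hAU hs, hQV ?_⟩
    dsimp only at hst
    subst hst
    exact hQ'
  refine ⟨Ultrafilter.of 𝓕, ultrafilter_map_eq_of_le ?_, ultrafilter_map_eq_of_le ?_⟩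
  · exact Filter.map_le_iff_le_comap.2 ((Ultrafilter.of_le _).trans inf_le_right)
  · exact Filter.map_le_iff_le_comap.2 ((Ultrafilter.of_le _).trans inf_le_left)

/-- If every set of `𝔭` and every set of `𝔵` is related to `𝔔`-almost all elements, there is an
ultrafilter over `𝔭` and `𝔵` whose sets are simultaneously related to the sets of `𝔔`. -/
theorem exists_ultrafilter_related (𝔔 : Ultrafilter S) (𝔭 : Ultrafilter T) (𝔵 : Ultrafilter X)
    (R₁ : S → T → Prop) (R₂ : S → X → Prop)
    (h₁ : ∀ P ∈ 𝔭, {s | ∃ t ∈ P, R₁ s t} ∈ 𝔔) (h₂ : ∀ A ∈ 𝔵, {s | ∃ x ∈ A, R₂ s x} ∈ 𝔔) :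
    ∃ 𝔴 : Ultrafilter (T × X), 𝔴.map Prod.fst = 𝔭 ∧ 𝔴.map Prod.snd = 𝔵 ∧
      ∀ Q ∈ 𝔔, {p : T × X | ∃ s ∈ Q, R₁ s p.1 ∧ R₂ s p.2} ∈ 𝔴 := by
  let g : Set S → Set (T × X) := fun Q => {p | ∃ s ∈ Q, R₁ s p.1 ∧ R₂ s p.2}
  have hg : Monotone g := fun Q Q' hQ p ⟨s, hs, hp⟩ => ⟨s, hQ hs, hp⟩
  let 𝓕 : Filter (T × X) := (𝔔 : Filter S).lift' g ⊓ ((𝔭 : Filter T) ×ˢ (𝔵 : Filter X))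
  have hne : 𝓕.NeBot := by
    rw [Filter.inf_neBot_iff]
    intro U hU V hV
    obtain ⟨Q, hQ, hQU⟩ := (Filter.mem_lift'_sets hg).1 hU
    obtain ⟨P, hP, A, hA, hPA⟩ := Filter.mem_prod_iff.1 hV
    obtain ⟨s, hs, ⟨t, ht, hst⟩, x, hx, hsx⟩ :=
      𝔔.nonempty_of_mem (Filter.inter_mem hQ (Filter.inter_mem (h₁ P hP) (h₂ A hA)))
    exact ⟨(t, x), hQU ⟨s, hs, hst, hsx⟩, hPA ⟨ht, hx⟩⟩
  have hle := Ultrafilter.of_le 𝓕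
  refine ⟨Ultrafilter.of 𝓕, ultrafilter_map_eq_of_le ?_, ultrafilter_map_eq_of_le ?_, ?_⟩
  · exact Filter.tendsto_fst.mono_left (hle.trans inf_le_right)
  · exact Filter.tendsto_snd.mono_left (hle.trans inf_le_right)
  · exact fun Q hQ => hle.trans inf_le_left (Filter.mem_lift' hQ)

end Ultrafilters

/-! ### The multiplication of the ultrafilter monad. -/

section UltraMul

variable {X Y : Type w}

/-- The hypothesis says that `𝓕` is compatible with the filter generated by the sets `{𝔶 | A ∈ 𝔶}`,
`A ∈ 𝔵`; every ultrafilter finer than both multiplies to `𝔵`. -/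
theorem exists_ultraMul_eq (𝓕 : Filter (Ultrafilter X)) (𝔵 : Ultrafilter X)
    (h : ∀ 𝒮 ∈ 𝓕, ∀ A ∈ 𝔵, ∃ 𝔶 ∈ 𝒮, A ∈ 𝔶) :
    ∃ 𝔛 : Ultrafilter (Ultrafilter X), (𝔛 : Filter (Ultrafilter X)) ≤ 𝓕 ∧ ultraMul 𝔛 = 𝔵 := by
  let g : Set X → Set (Ultrafilter X) := fun A => {𝔶 | A ∈ 𝔶}
  have hg : Monotone g := fun A B hAB 𝔶 hA => Filter.mem_of_superset hA hAB
  have hne : (𝓕 ⊓ (𝔵 : Filter X).lift' g).NeBot := by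
    rw [Filter.inf_neBot_iff]
    intro U hU V hV
    obtain ⟨A, hA, hAV⟩ := (Filter.mem_lift'_sets hg).1 hV
    obtain ⟨𝔶, h1, h2⟩ := h U hU A hA
    exact ⟨𝔶, h1, hAV h2⟩
  have hle := Ultrafilter.of_le (𝓕 ⊓ (𝔵 : Filter X).lift' g)
  refine ⟨Ultrafilter.of _, hle.trans inf_le_left, Ultrafilter.coe_le_coe.1 fun A hA => ?_⟩
  exact mem_ultraMul.2 (hle.trans inf_le_right (Filter.mem_lift' hA))

theorem ultraMul_map (f : X → Y) (𝔛 : Ultrafilter (Ultrafilter X)) :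
    ultraMul (𝔛.map (Ultrafilter.map f)) = (ultraMul 𝔛).map f :=
  Ultrafilter.ext fun _ => Iff.rfl

theorem ultraMul_pure (𝔵 : Ultrafilter X) : ultraMul (pure 𝔵) = 𝔵 :=
  Ultrafilter.ext fun _ => Iff.rfl

/-- The naturality squares of the multiplication are weak pullbacks. -/
theorem exists_ultraMul_lift (f : X → Y) (𝔮 : Ultrafilter X) (𝔓 : Ultrafilter (Ultrafilter Y))
    (h : ultraMul 𝔓 = 𝔮.map f) :
    ∃ 𝔔 : Ultrafilter (Ultrafilter X), ultraMul 𝔔 = 𝔮 ∧ 𝔔.map (Ultrafilter.map f) = 𝔓 := by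
  obtain ⟨𝔔, h1, h2⟩ := exists_ultraMul_eq (Filter.comap (Ultrafilter.map f) 𝔓) 𝔮 (by
    rintro 𝒮 ⟨V, hV, hs⟩ Q hQ
    have hQ' : f '' Q ∈ ultraMul 𝔓 := by
      rw [h]
      exact Filter.image_mem_map hQ
    obtain ⟨𝔭, h𝔭, hQ𝔭⟩ := 𝔓.nonempty_of_mem (Filter.inter_mem hV (mem_ultraMul.1 hQ'))
    obtain ⟨𝔰, hs1, rfl⟩ := exists_ultrafilter_map_eq f 𝔭 hQ𝔭
    exact ⟨𝔰, hs h𝔭, hs1⟩)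
  exact ⟨𝔔, h2, ultrafilter_map_eq_of_le (Filter.map_le_iff_le_comap.2 h1)⟩

end UltraMul

/-! ### Estimates for the extension of numerical relations. -/

section UltraExt

variable {X Y : Type w} {r : X → Y → ℝ≥0∞} {𝔵 : Ultrafilter X} {𝔶 : Ultrafilter Y} {t : ℝ≥0∞}

theorem ultraExt_le (h : ∀ A ∈ 𝔵, ∀ B ∈ 𝔶, ∃ x ∈ A, ∃ y ∈ B, r x y ≤ t) :
    ultraExt r 𝔵 𝔶 ≤ t := by
  refine iSup₂_le fun A hA => iSup₂_le fun B hB => ?_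
  obtain ⟨x, hx, y, hy, hxy⟩ := h A hA B hB
  exact (iInf₂_le x hx).trans ((iInf₂_le y hy).trans hxy)

theorem exists_lt_of_ultraExt_lt (h : ultraExt r 𝔵 𝔶 < t) {A : Set X} {B : Set Y}
    (hA : A ∈ 𝔵) (hB : B ∈ 𝔶) : ∃ x ∈ A, ∃ y ∈ B, r x y < t := by
  have h1 : ⨅ x ∈ A, ⨅ y ∈ B, r x y < t :=
    lt_of_le_of_lt (le_iSup₂_of_le (f := fun A (_ : A ∈ 𝔵) =>
      ⨆ B ∈ 𝔶, ⨅ x ∈ A, ⨅ y ∈ B, r x y) A hA (le_iSup₂_of_le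
        (f := fun B (_ : B ∈ 𝔶) => ⨅ x ∈ A, ⨅ y ∈ B, r x y) B hB le_rfl)) h
  simpa only [iInf_lt_iff, exists_prop] using h1

theorem setOf_exists_lt_mem (h : ultraExt r 𝔵 𝔶 < t) {B : Set Y} (hB : B ∈ 𝔶) :
    {x | ∃ y ∈ B, r x y < t} ∈ 𝔵 := by
  by_contra hn
  obtain ⟨x, hx, hy⟩ := exists_lt_of_ultraExt_lt h (Ultrafilter.compl_mem_iff_notMem.2 hn) hB
  exact hx hy

theorem ultraExt_map_map_le {S : Type w} (𝔰 : Ultrafilter S) (f : S → X) (g : S → Y)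
    {A : Set S} (hA : A ∈ 𝔰) (h : ∀ s ∈ A, r (f s) (g s) ≤ t) :
    ultraExt r (𝔰.map f) (𝔰.map g) ≤ t :=
  ultraExt_le fun B hB C hC => by
    obtain ⟨s, hs, hB', hC'⟩ := 𝔰.nonempty_of_mem (Filter.inter_mem hA (Filter.inter_mem hB hC))
    exact ⟨f s, hB', g s, hC', h s hs⟩

end UltraExt

/-! ### Distance, contractions and products through convergence. -/

section Conv

variable {X Y Z : Type w} [ApproachSpace X] [ApproachSpace Y] [ApproachSpace Z]

theorem δ_le_conv {𝔵 : Ultrafilter X} {A : Set X} (hA : A ∈ 𝔵) (x : X) : δ A x ≤ conv 𝔵 x :=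
  le_iSup₂_of_le (f := fun A (_ : A ∈ 𝔵) => δ A x) A hA le_rfl

/-- The distance to a nonempty set is attained by the convergence of an ultrafilter on it. -/
theorem exists_conv_le_δ {A : Set X} (hA : A.Nonempty) (x : X) :
    ∃ 𝔵 : Ultrafilter X, A ∈ 𝔵 ∧ conv 𝔵 x ≤ δ A x := by
  by_cases htop : δ A x = ∞
  · obtain ⟨y, hy⟩ := hA
    exact ⟨pure y, hy, by simp [htop]⟩
  -- The sets whose removal from `A` strictly increases the distance to `x`. Finite additivity of
  -- `δ` makes them a filter. If a member `C` of a finer ultrafilter were farther from `x` than `A`,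
  -- then `Cᶜ` would lie in `𝓕`.
  let 𝓕 : Filter X :=
    { sets := {B | δ A x < δ (A \ B) x}
      univ_sets := by
        have : δ A x < ∞ := lt_top_iff_ne_top.2 htop
        simpa [δ_empty] using this
      sets_of_superset := fun {B C} (hB : _ < _) hBC =>
        lt_of_lt_of_le hB (δ_mono (Set.sdiff_subset_sdiff_right hBC) x)
      inter_sets := fun {B C} (hB : _ < _) (hC : _ < _) => by
        change δ A x < δ (A \ (B ∩ C)) x
        rw [Set.sdiff_inter, δ_union]
        exact lt_min hB hC }
  have hne : 𝓕.NeBot := by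
    refine ⟨fun h => ?_⟩
    have h0 : δ A x < δ (A \ ∅) x := (h ▸ Filter.mem_bot : ∅ ∈ 𝓕)
    simp at h0
  have hle := Ultrafilter.of_le 𝓕
  refine ⟨Ultrafilter.of 𝓕, hle ?_, iSup₂_le fun C hC => ?_⟩
  · change δ A x < δ (A \ A) x
    simpa [δ_empty] using lt_top_iff_ne_top.2 htop
  · by_contra! hlt
    have hC' : Cᶜ ∈ 𝓕 := by
      change δ A x < δ (A \ Cᶜ) x
      rw [Set.sdiff_compl]
      exact lt_of_lt_of_le hlt (δ_mono Set.inter_subset_right x)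
    exact Ultrafilter.compl_notMem_iff.2 hC (hle hC')

theorem conv_pure_eq (x y : X) : conv (pure x) y = δ {x} y :=
  le_antisymm (iSup₂_le fun A (hA : x ∈ A) => δ_mono (Set.singleton_subset_iff.2 hA) y)
    (δ_le_conv (Set.mem_singleton x) y)

/-- Transitivity is the enlargement axiom with `ε` slightly above `ultraExt conv 𝔛 𝔵`: for `A ∈
ultraMul 𝔛`, the `ε`-enlargement of `A` then belongs to `𝔵`. -/
theorem conv_ultraMul_le (𝔛 : Ultrafilter (Ultrafilter X)) (𝔵 : Ultrafilter X) (x : X) :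
    conv (ultraMul 𝔛) x ≤ conv 𝔵 x + ultraExt conv 𝔛 𝔵 := by
  refine iSup₂_le fun A hA => ?_
  refine ENNReal.le_of_forall_pos_le_add fun ε hε hfin => ?_
  have hlt : ultraExt conv 𝔛 𝔵 < ultraExt conv 𝔛 𝔵 + ε :=
    ENNReal.lt_add_right (ne_top_of_le_ne_top hfin.ne le_add_self) (by simpa using hε.ne')
  have hB : {y | δ A y ≤ ultraExt conv 𝔛 𝔵 + ε} ∈ 𝔵 := by
    by_contra hn
    obtain ⟨𝔞, h𝔞, y, hy, hlt'⟩ :=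
      exists_lt_of_ultraExt_lt hlt (mem_ultraMul.1 hA) (Ultrafilter.compl_mem_iff_notMem.2 hn)
    exact hy ((δ_le_conv h𝔞 y).trans hlt'.le)
  rw [add_assoc]
  exact (δ_enlarge A x _).trans (add_le_add_left (δ_le_conv hB x) _)

theorem isContraction_iff_conv {f : X → Y} :
    IsContraction f ↔ ∀ (𝔵 : Ultrafilter X) (x : X), conv (𝔵.map f) (f x) ≤ conv 𝔵 x := by
  refine ⟨fun h 𝔵 x => iSup₂_le fun B hB => ?_, fun h A x => ?_⟩
  · exact (δ_mono (Set.image_preimage_subset f B) _).trans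
      ((h _ x).trans (δ_le_conv (𝔵 := 𝔵) (A := f ⁻¹' B) hB x))
  · obtain rfl | hA := A.eq_empty_or_nonempty
    · simp [δ_empty]
    obtain ⟨𝔵, hA𝔵, hle⟩ := exists_conv_le_δ hA x
    exact (δ_le_conv (𝔵 := 𝔵.map f) (Filter.image_mem_map hA𝔵) _).trans ((h 𝔵 x).trans hle)

/-- The finite covers in the product distance disappear because an ultrafilter containing a finite
union contains one of its pieces. -/
theorem conv_prod (𝔴 : Ultrafilter (X × Y)) (p : X × Y) :
    conv 𝔴 p = conv (𝔴.map Prod.fst) p.1 ⊔ conv (𝔴.map Prod.snd) p.2 := by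
  refine le_antisymm (iSup₂_le fun A hA => iSup₂_le fun F hF => ?_)
    (sup_le (isContraction_iff_conv.1 isContraction_fst 𝔴 p)
      (isContraction_iff_conv.1 isContraction_snd 𝔴 p))
  obtain ⟨B, hB, hB𝔴⟩ : ∃ B ∈ F, B ∈ 𝔴 := by
    have := Filter.mem_of_superset hA hF
    exact (Ultrafilter.finite_biUnion_mem_iff F.finite_toSet).1 this
  exact (iInf₂_le B hB).trans (max_le_max
    (δ_le_conv (𝔵 := 𝔴.map Prod.fst) (Filter.image_mem_map hB𝔴) _)
    (δ_le_conv (𝔵 := 𝔴.map Prod.snd) (Filter.image_mem_map hB𝔴) _))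

theorem isContraction_const (y : Y) : IsContraction (fun _ : X => y) := fun A x => by
  obtain rfl | ⟨z, hz⟩ := A.eq_empty_or_nonempty
  · simp [δ_empty]
  · rw [δ_of_mem (Set.mem_image_of_mem _ hz)]
    exact bot_le

end Conv

/-! ### Approach spaces from convergence relations. -/

section OfConv

variable {X : Type w}

/-- The approach space determined by a reflexive and transitive ultrafilter convergence. -/
noncomputable abbrev ofConv (a : Ultrafilter X → X → ℝ≥0∞) (refl : ∀ x, a (pure x) x = 0)
    (trans : ∀ 𝔛 𝔵 x, a (ultraMul 𝔛) x ≤ a 𝔵 x + ultraExt a 𝔛 𝔵) : ApproachSpace X where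
  δ A x := ⨅ (𝔵 : Ultrafilter X) (_ : A ∈ 𝔵), a 𝔵 x
  δ_singleton x := le_antisymm ((iInf₂_le (pure x) (Set.mem_singleton x)).trans (refl x).le) bot_le
  δ_empty x := by
    refine top_unique (le_iInf₂ fun 𝔵 h => ?_)
    exact absurd h 𝔵.empty_notMem
  δ_union A B x := by
    refine le_antisymm (le_min ?_ ?_) (le_iInf₂ fun 𝔵 h => ?_)
    · exact le_iInf₂ fun 𝔵 h => iInf₂_le 𝔵 (Filter.mem_of_superset h Set.subset_union_left)
    · exact le_iInf₂ fun 𝔵 h => iInf₂_le 𝔵 (Filter.mem_of_superset h Set.subset_union_right)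
    · rcases Ultrafilter.union_mem_iff.1 h with h | h
      · exact (min_le_left _ _).trans (iInf₂_le 𝔵 h)
      · exact (min_le_right _ _).trans (iInf₂_le 𝔵 h)
  δ_enlarge A x ε := by
    rw [ENNReal.iInf_add]
    refine le_iInf fun 𝔵 => ?_
    rw [ENNReal.iInf_add]
    refine le_iInf fun h𝔵 => ?_
    refine ENNReal.le_of_forall_pos_le_add fun η hη hfin => ?_
    have hε : ε ≠ ∞ := ne_top_of_le_ne_top hfin.ne le_add_self
    -- Each `y` in the enlargement gets a nearly optimal ultrafilter on `A`; multiplying these along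
    -- `𝔵` gives one ultrafilter on `A`, to which `trans` applies. Elsewhere `pure y` is a dummy
    -- value.
    have hex : ∀ y : X, ∃ 𝔞 : Ultrafilter X,
        (⨅ (𝔵 : Ultrafilter X) (_ : A ∈ 𝔵), a 𝔵 y) ≤ ε → A ∈ 𝔞 ∧ a 𝔞 y ≤ ε + η := by
      intro y
      by_cases hy : (⨅ (𝔵 : Ultrafilter X) (_ : A ∈ 𝔵), a 𝔵 y) ≤ ε
      · have hlt := lt_of_le_of_lt hy
          (ENNReal.lt_add_right hε (by simpa using hη.ne' : (η : ℝ≥0∞) ≠ 0))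
        simp only [iInf_lt_iff] at hlt
        obtain ⟨𝔞, hA, hlt⟩ := hlt
        exact ⟨𝔞, fun _ => ⟨hA, hlt.le⟩⟩
      · exact ⟨pure y, fun h => absurd h hy⟩
    choose s hs using hex
    have hA : A ∈ ultraMul (𝔵.map s) :=
      by
      refine mem_ultraMul.2 (Ultrafilter.mem_map.2 (Filter.mem_of_superset h𝔵 ?_))
      exact fun y hy => (hs y hy).1
    refine (iInf₂_le (f := fun 𝔶 (_ : A ∈ 𝔶) => a 𝔶 x) (ultraMul (𝔵.map s)) hA).trans
      ((trans (𝔵.map s) 𝔵 x).trans ?_)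
    rw [add_assoc]
    gcongr
    simpa using ultraExt_map_map_le (r := a) 𝔵 s id h𝔵 fun y hy => (hs y hy).2

/-- For the nontrivial bound, every set of `𝔵` carries an ultrafilter nearly within `conv 𝔵 x` of
`x`. These assemble to some `𝔛` with product `𝔵`, and transitivity through `pure x` gives the
estimate. -/
theorem conv_ofConv (a : Ultrafilter X → X → ℝ≥0∞) (refl : ∀ x, a (pure x) x = 0)
    (trans : ∀ 𝔛 𝔵 x, a (ultraMul 𝔛) x ≤ a 𝔵 x + ultraExt a 𝔛 𝔵)
    (𝔵 : Ultrafilter X) (x : X) :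
    @conv X (ofConv a refl trans) 𝔵 x = a 𝔵 x := by
  let _ := ofConv a refl trans
  refine le_antisymm (iSup₂_le fun A hA => iInf₂_le 𝔵 hA) ?_
  refine ENNReal.le_of_forall_pos_le_add fun η hη hfin => ?_
  have hlt : conv 𝔵 x < conv 𝔵 x + η := ENNReal.lt_add_right hfin.ne (by simpa using hη.ne')
  obtain ⟨𝔛, h𝔛, rfl⟩ := exists_ultraMul_eq
    (Filter.principal {𝔶 : Ultrafilter X | a 𝔶 x ≤ conv 𝔵 x + η}) 𝔵 (by
      intro 𝒮 h𝒮 A hA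
      have h1 := lt_of_le_of_lt (δ_le_conv hA x) hlt
      change (⨅ (𝔵 : Ultrafilter X) (_ : A ∈ 𝔵), a 𝔵 x) < _ at h1
      simp only [iInf_lt_iff] at h1
      obtain ⟨𝔶, hA𝔶, h2⟩ := h1
      exact ⟨𝔶, h𝒮 h2.le, hA𝔶⟩)
  refine (trans 𝔛 (pure x) x).trans ?_
  rw [refl, zero_add]
  refine ultraExt_le fun 𝒜 h𝒜 B hB => ?_
  obtain ⟨𝔶, h1, h2⟩ :=
    𝔛.nonempty_of_mem (Filter.inter_mem h𝒜 (h𝔛 (Filter.mem_principal_self _)))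
  exact ⟨𝔶, h1, x, hB, h2⟩

end OfConv

end ApproachSpace

namespace ApproachSpace

/-! ### Convergence on the function space. -/

section Exponential

variable {X Y Z : Type w} [ApproachSpace X] [ApproachSpace Y] [ApproachSpace Z]

/-- The contractions from `X` to `Y`. -/
abbrev Contraction (X Y : Type w) [ApproachSpace X] [ApproachSpace Y] : Type w :=
  {h : X → Y // IsContraction h}

/-- The evaluation map. -/
def eval (p : Contraction X Y × X) : Y := p.1.1 p.2

/-- The convergence on the function space: the least `v` for which evaluation contracts at `h`
along every ultrafilter over `𝔭`. -/
noncomputable def expConv (𝔭 : Ultrafilter (Contraction X Y)) (h : Contraction X Y) : ℝ≥0∞ :=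
  sInf {v | ∀ 𝔮 : Ultrafilter (Contraction X Y × X), 𝔮.map Prod.fst = 𝔭 → ∀ x : X,
    conv (𝔮.map eval) (h.1 x) ≤ v ⊔ conv (𝔮.map Prod.snd) x}

/-- The infimum defining `expConv` is attained. -/
theorem conv_map_eval_le (𝔮 : Ultrafilter (Contraction X Y × X)) (h : Contraction X Y) (x : X) :
    conv (𝔮.map eval) (h.1 x) ≤ expConv (𝔮.map Prod.fst) h ⊔ conv (𝔮.map Prod.snd) x := by
  refine le_of_forall_gt_imp_ge_of_dense fun t ht => ?_
  obtain ⟨v, hv, hvt⟩ := sInf_lt_iff.1 (lt_of_le_of_lt le_sup_left ht)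
  exact (hv 𝔮 rfl x).trans (sup_le hvt.le (le_sup_right.trans ht.le))

theorem expConv_pure (h : Contraction X Y) : expConv (pure h) h = 0 := by
  refine le_antisymm (sInf_le fun 𝔮 h𝔮 x => ?_) bot_le
  have hev : 𝔮.map eval = (𝔮.map Prod.snd).map h.1 := by
    refine Ultrafilter.coe_injective ?_
    simp only [Ultrafilter.coe_map, Filter.map_map]
    refine Filter.map_congr ?_
    have hmem : Prod.fst ⁻¹' {h} ∈ 𝔮 := by
      rw [← Ultrafilter.mem_map, h𝔮]
      exact Set.mem_singleton h
    filter_upwards [hmem] with p hp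
    rw [Set.mem_preimage, Set.mem_singleton_iff] at hp
    simp [eval, hp]
  rw [hev]
  exact (isContraction_iff_conv.1 h.2 _ x).trans le_sup_right

/-- The one place where the inequality is needed, with `u = expConv 𝔭 h` and `v = ultraExt expConv 𝔓
𝔭`. -/
theorem expConv_ultraMul_le
    (hX : ∀ (𝔛 : Ultrafilter (Ultrafilter X)) (x₀ : X) (u v : ℝ≥0∞),
      ⨅ 𝔵 : Ultrafilter X, (u ⊔ conv 𝔵 x₀) + (v ⊔ ultraExt conv 𝔛 𝔵) ≤
        (u + v) ⊔ conv (ultraMul 𝔛) x₀)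
    (𝔓 : Ultrafilter (Ultrafilter (Contraction X Y))) (𝔭 : Ultrafilter (Contraction X Y))
    (h : Contraction X Y) :
    expConv (ultraMul 𝔓) h ≤ expConv 𝔭 h + ultraExt expConv 𝔓 𝔭 := by
  refine sInf_le fun 𝔮 h𝔮 x => ?_
  obtain ⟨𝔔, rfl, rfl⟩ := exists_ultraMul_lift Prod.fst 𝔮 𝔓 h𝔮.symm
  refine le_trans ?_ ((hX (𝔔.map (Ultrafilter.map Prod.snd)) x _ _).trans_eq
    (by rw [ultraMul_map]))
  refine le_iInf fun 𝔵 => ?_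
  refine ENNReal.le_of_forall_pos_le_add fun ε hε hfin => ?_
  set s := ultraExt expConv (𝔔.map (Ultrafilter.map Prod.fst)) 𝔭 ⊔
    ultraExt conv (𝔔.map (Ultrafilter.map Prod.snd)) 𝔵
  have hlt : s < s + ε :=
    ENNReal.lt_add_right (ne_top_of_le_ne_top hfin.ne le_add_self) (by simpa using hε.ne')
  -- A single `𝔴` over both `𝔭` and `𝔵` is required, so that evaluation along `𝔴` can be the
  -- intermediate ultrafilter for transitivity in `Y`.
  obtain ⟨𝔴, rfl, rfl, h𝔴⟩ := exists_ultrafilter_related 𝔔 𝔭 𝔵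
    (fun 𝔮 k => expConv (𝔮.map Prod.fst) k < s + ε)
    (fun 𝔮 y => conv (𝔮.map Prod.snd) y < s + ε)
    (fun P hP => setOf_exists_lt_mem (lt_of_le_of_lt le_sup_left hlt) hP)
    (fun A hA => setOf_exists_lt_mem (lt_of_le_of_lt le_sup_right hlt) hA)
  rw [← ultraMul_map]
  refine (conv_ultraMul_le _ (𝔴.map eval) _).trans ?_
  rw [add_assoc]
  refine add_le_add (conv_map_eval_le 𝔴 h x) (ultraExt_le fun 𝒜 h𝒜 B hB => ?_)
  obtain ⟨p, ⟨𝔯, h𝔯, h1, h2⟩, hp⟩ := 𝔴.nonempty_of_mem (Filter.inter_mem (h𝔴 _ h𝒜) hB)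
  exact ⟨_, h𝔯, _, hp, (conv_map_eval_le 𝔯 p.1 p.2).trans (sup_le h1.le h2.le)⟩

/-- Every ultrafilter tested by `expConv` lifts to `Z × X` by weak pullback preservation, where
contractivity of `g` applies. -/
theorem expConv_map_curry_le (g : Z × X → Y) (hg : IsContraction g)
    (k : Z → Contraction X Y) (hk : ∀ z x, (k z).1 x = g (z, x))
    (𝔷 : Ultrafilter Z) (z : Z) : expConv (𝔷.map k) (k z) ≤ conv 𝔷 z := by
  refine sInf_le fun 𝔮 h𝔮 x => ?_
  obtain ⟨𝔯, rfl, rfl⟩ := exists_ultrafilter_prod_lift k 𝔷 𝔮 h𝔮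
  have h1 : (𝔯.map (Prod.map k id)).map eval = 𝔯.map g := by
    rw [Ultrafilter.map_map]
    congr 1
    funext p
    exact hk p.1 p.2
  rw [h1, hk, Ultrafilter.map_map]
  exact (isContraction_iff_conv.1 hg 𝔯 (z, x)).trans_eq (conv_prod 𝔯 (z, x))

theorem isContraction_uncurry (k : Z → Contraction X Y)
    (hk : ∀ (𝔷 : Ultrafilter Z) (z : Z), expConv (𝔷.map k) (k z) ≤ conv 𝔷 z) :
    IsContraction fun p : Z × X => (k p.1).1 p.2 := by
  refine isContraction_iff_conv.2 fun 𝔴 p => ?_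
  have h := conv_map_eval_le (𝔴.map (Prod.map k id)) (k p.1) p.2
  simp only [Ultrafilter.map_map] at h
  refine h.trans (le_trans (sup_le_sup_right ?_ _) (conv_prod 𝔴 p).ge)
  exact hk (𝔴.map Prod.fst) p.1

theorem IsContraction.curry {g : Z × X → Y} (hg : IsContraction g) (z : Z) :
    IsContraction fun x => g (z, x) :=
  hg.comp ((isContraction_const z).prodMk isContraction_id)

end Exponential

end ApproachSpace

namespace AppCat

/-! ### The currying adjunction. -/

section

variable {X : Type w} [ApproachSpace X]
  (hX : ∀ (𝔛 : Ultrafilter (Ultrafilter X)) (x₀ : X) (u v : ℝ≥0∞),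
    ⨅ 𝔵 : Ultrafilter X, (u ⊔ conv 𝔵 x₀) + (v ⊔ ultraExt conv 𝔛 𝔵) ≤
      (u + v) ⊔ conv (ultraMul 𝔛) x₀)

/-- The exponential of `Y` by a space satisfying the exponentiability inequality. -/
noncomputable def exp (Y : AppCat.{w}) : AppCat.{w} :=
  @of (Contraction X Y.carrier) (ofConv expConv expConv_pure (expConv_ultraMul_le hX))

theorem conv_exp (Y : AppCat.{w}) (𝔭 : Ultrafilter (exp hX Y).carrier)
    (h : (exp hX Y).carrier) : conv 𝔭 h = expConv (X := X) (Y := Y.carrier) 𝔭 h :=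
  conv_ofConv expConv expConv_pure (expConv_ultraMul_le hX) 𝔭 h

/-- Currying: maps `Z × X ⟶ Y` correspond to maps from `Z` into the exponential. -/
noncomputable def curryEquiv (Z Y : AppCat.{w}) :
    ((prodFunctor (of X)).obj Z ⟶ Y) ≃ (Z ⟶ exp hX Y) where
  toFun g := ⟨fun z => (⟨fun x => g.toFun (z, x), g.contraction.curry z⟩ :
    Contraction X Y.carrier), isContraction_iff_conv.2 fun 𝔷 z => (conv_exp hX Y _ _).trans_le
      (expConv_map_curry_le g.toFun g.contraction _ (fun _ _ => rfl) 𝔷 z)⟩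
  invFun k := ⟨fun p => (k.toFun p.1 : Contraction X Y.carrier).1 p.2,
    isContraction_uncurry k.toFun fun 𝔷 z => (conv_exp hX Y _ _).symm.trans_le
      (isContraction_iff_conv.1 k.contraction 𝔷 z)⟩
  left_inv _ := rfl
  right_inv _ := rfl

end

theorem isExponentiable_of_le {X : Type w} [ApproachSpace X]
    (hX : ∀ (𝔛 : Ultrafilter (Ultrafilter X)) (x₀ : X) (u v : ℝ≥0∞),
      ⨅ 𝔵 : Ultrafilter X, (u ⊔ conv 𝔵 x₀) + (v ⊔ ultraExt conv 𝔛 𝔵) ≤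
        (u + v) ⊔ conv (ultraMul 𝔛) x₀) : IsExponentiable (of X) :=
  (Adjunction.adjunctionOfEquivRight (F := prodFunctor (of X)) (curryEquiv hX)
    (fun _ _ _ _ _ => rfl)).isLeftAdjoint

end AppCat

namespace ApproachSpace

/-! ### The test object `[0,∞]` and contractions into it. -/

section ENNRealSpace

/-- The approach space `[0,∞]` with `δ (A, y) = y - sup A` for nonempty `A`. -/
noncomputable instance ennrealSpace : ApproachSpace (ULift.{w} ℝ≥0∞) where
  δ A y := ⨅ _ : A.Nonempty, y.down - ⨆ a ∈ A, a.down
  δ_singleton x := by simp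
  δ_empty x := by simp
  δ_union A B x := by
    obtain rfl | hA := A.eq_empty_or_nonempty
    · simp
    obtain rfl | hB := B.eq_empty_or_nonempty
    · simp
    simp only [hA, hB, hA.inl, iInf_pos, iSup_union]
    have hanti : Antitone fun t : ℝ≥0∞ => x.down - t := fun _ _ h => tsub_le_tsub_left h _
    exact hanti.map_sup _ _
  δ_enlarge A x ε := by
    obtain rfl | hA := A.eq_empty_or_nonempty
    · by_cases hε : ε = ∞
      · simp [hε]
      · simp [hε]
    simp only [hA, iInf_pos]
    rw [ENNReal.iInf_add]
    refine le_iInf fun _ => tsub_le_iff_right.2 ?_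
    have hsup : ⨆ a ∈ {y : ULift.{w} ℝ≥0∞ | y.down - ⨆ a ∈ A, a.down ≤ ε}, a.down ≤
        ε + ⨆ a ∈ A, a.down := iSup₂_le fun a ha => tsub_le_iff_right.1 ha
    calc x.down ≤ (x.down - ⨆ a ∈ {y : ULift.{w} ℝ≥0∞ | y.down - ⨆ a ∈ A, a.down ≤ ε}, a.down) +
          ⨆ a ∈ {y : ULift.{w} ℝ≥0∞ | y.down - ⨆ a ∈ A, a.down ≤ ε}, a.down := le_tsub_add
      _ ≤ _ := by
        rw [add_assoc]
        exact add_le_add_right hsup _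

variable {X : Type w} [ApproachSpace X]

theorem isContraction_up_iff {f : X → ℝ≥0∞} :
    IsContraction (fun x => (ULift.up (f x) : ULift.{w} ℝ≥0∞)) ↔
      ∀ (𝔵 : Ultrafilter X) (x : X), ∀ A ∈ 𝔵, f x ≤ conv 𝔵 x + ⨆ a ∈ A, f a := by
  have key : ∀ (A : Set X) (x : X), A.Nonempty →
      δ ((fun x => (ULift.up (f x) : ULift.{w} ℝ≥0∞)) '' A) (ULift.up (f x)) =
        f x - ⨆ a ∈ A, f a := by
    intro A x hA
    change (⨅ _ : Set.Nonempty _, _) = _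
    rw [iInf_pos (hA.image _), iSup_image]
  refine ⟨fun h 𝔵 x A hA => ?_, fun h A x => ?_⟩
  · rw [← tsub_le_iff_right, ← key A x (𝔵.nonempty_of_mem hA)]
    exact (h A x).trans (δ_le_conv hA x)
  · obtain rfl | hA := A.eq_empty_or_nonempty
    · simp [δ_empty]
    obtain ⟨𝔵, hA𝔵, hle⟩ := exists_conv_le_δ hA x
    rw [key A x hA, tsub_le_iff_right]
    exact (h 𝔵 x A hA𝔵).trans (add_le_add_left hle _)

theorem isContraction_up_δ_singleton (x : X) :
    IsContraction fun y => (ULift.up (δ {x} y) : ULift.{w} ℝ≥0∞) := by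
  refine isContraction_up_iff.2 fun 𝔶 y A hA => (δ_enlarge {x} y (⨆ a ∈ A, δ {x} a)).trans ?_
  refine add_le_add_left (δ_le_conv (Filter.mem_of_superset hA fun a ha => ?_) y) _
  exact le_iSup₂_of_le (f := fun a (_ : a ∈ A) => δ {x} a) a ha le_rfl

/-- The `conv` part is transitivity applied to the principal ultrafilter at `𝔞`. -/
theorem isContraction_up_sup_conv (v : ℝ≥0∞) (𝔞 : Ultrafilter X) :
    IsContraction fun y => (ULift.up (v ⊔ conv 𝔞 y) : ULift.{w} ℝ≥0∞) := by
  refine isContraction_up_iff.2 fun 𝔶 y A hA => sup_le ?_ ?_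
  · obtain ⟨a, ha⟩ := 𝔶.nonempty_of_mem hA
    exact le_add_left (le_iSup₂_of_le a ha le_sup_left)
  · have h := conv_ultraMul_le (pure 𝔞) 𝔶 y
    rw [ultraMul_pure] at h
    refine h.trans (add_le_add_right (ultraExt_le fun 𝒜 h𝒜 B hB => ?_) _)
    obtain ⟨a, ha, haB⟩ := 𝔶.nonempty_of_mem (Filter.inter_mem hA hB)
    exact ⟨𝔞, h𝒜, a, haB, le_iSup₂_of_le a ha le_sup_right⟩

theorem isContraction_up_iInf (𝔛 : Ultrafilter (Ultrafilter X)) (u v : ℝ≥0∞) :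
    IsContraction fun y => (ULift.up (⨅ 𝔵 : Ultrafilter X, (u ⊔ conv 𝔵 y) +
      (v ⊔ ultraExt conv 𝔛 𝔵)) : ULift.{w} ℝ≥0∞) := by
  refine isContraction_up_iff.2 fun 𝔶 y A hA => ?_
  set ψ : X → ℝ≥0∞ := fun y => ⨅ 𝔵 : Ultrafilter X, (u ⊔ conv 𝔵 y) + (v ⊔ ultraExt conv 𝔛 𝔵)
  refine ENNReal.le_of_forall_pos_le_add fun ε hε hfin => ?_
  set L := ⨆ a ∈ A, ψ a
  have hlt : L < L + ε :=
    ENNReal.lt_add_right (ne_top_of_le_ne_top hfin.ne le_add_self) (by simpa using hε.ne')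
  have hex : ∀ a : X, ∃ 𝔵 : Ultrafilter X, a ∈ A →
      (u ⊔ conv 𝔵 a) + (v ⊔ ultraExt conv 𝔛 𝔵) ≤ L + ε := by
    intro a
    by_cases ha : a ∈ A
    · obtain ⟨𝔵, h𝔵⟩ := iInf_lt_iff.1
        (lt_of_le_of_lt (le_iSup₂_of_le (f := fun a (_ : a ∈ A) => ψ a) a ha le_rfl) hlt)
      exact ⟨𝔵, fun _ => h𝔵.le⟩
    · exact ⟨pure a, fun h => absurd h ha⟩
  -- The competitor at `y` is `ultraMul (𝔶.map s)`. Limits of the two summands along `𝔶` exist by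
  -- compactness and keep `α + β ≤ L + ε`; separate suprema over `A` could have a larger sum.
  choose s hs using hex
  obtain ⟨α, hα⟩ : ∃ α, Filter.Tendsto (fun a => u ⊔ conv (s a) a) 𝔶 (nhds α) :=
    ⟨_, (𝔶.map fun a => u ⊔ conv (s a) a).le_nhds_lim⟩
  obtain ⟨β, hβ⟩ : ∃ β, Filter.Tendsto (fun a => v ⊔ ultraExt conv 𝔛 (s a)) 𝔶 (nhds β) :=
    ⟨_, (𝔶.map fun a => v ⊔ ultraExt conv 𝔛 (s a)).le_nhds_lim⟩
  have hαβ : α + β ≤ L + ε := le_of_tendsto (hα.add hβ) (Filter.mem_of_superset hA hs)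
  have huα : u ≤ α := ge_of_tendsto' hα fun _ => le_sup_left
  have hvβ : v ≤ β := ge_of_tendsto' hβ fun _ => le_sup_left
  have h1 : ultraExt conv (𝔶.map s) 𝔶 ≤ α := by
    refine le_of_forall_gt_imp_ge_of_dense fun t ht => ?_
    have := ultraExt_map_map_le (r := conv) 𝔶 s id (hα.eventually (gt_mem_nhds ht))
      fun a ha => le_sup_right.trans (le_of_lt ha)
    simpa using this
  have h2 : ultraExt conv 𝔛 (ultraMul (𝔶.map s)) ≤ β := by
    refine le_of_forall_gt_imp_ge_of_dense fun t ht => ultraExt_le fun 𝒜 h𝒜 B hB => ?_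
    obtain ⟨a, ha, haB⟩ := 𝔶.nonempty_of_mem
      (Filter.inter_mem (hβ.eventually (gt_mem_nhds ht)) (mem_ultraMul.1 hB))
    obtain ⟨𝔞, h𝔞, b, hb, hlt⟩ := exists_lt_of_ultraExt_lt
      (lt_of_le_of_lt le_sup_right ha) h𝒜 haB
    exact ⟨𝔞, h𝔞, b, hb, hlt.le⟩
  calc ψ y ≤ (u ⊔ conv (ultraMul (𝔶.map s)) y) +
        (v ⊔ ultraExt conv 𝔛 (ultraMul (𝔶.map s))) := iInf_le _ _
    _ ≤ (conv 𝔶 y + α) + β := by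
        refine add_le_add (sup_le (le_add_left huα) ?_) (sup_le hvβ h2)
        exact (conv_ultraMul_le _ 𝔶 y).trans (add_le_add_right h1 _)
    _ ≤ conv 𝔶 y + L + ε := by
        rw [add_assoc, add_assoc]
        exact add_le_add_right hαβ _

end ENNRealSpace

/-! ### One-point extensions as test spaces. -/

section OnePoint

variable {S X : Type w} [ApproachSpace X]

open Classical in
/-- The discrete space `S` with one more point, to which `𝔰` converges at distance `r`. -/
noncomputable abbrev onePoint (𝔰 : Ultrafilter S) (r : ℝ≥0∞) : ApproachSpace (Option S) where
  δ A z := if z ∈ A then 0 else if z = none ∧ some ⁻¹' A ∈ 𝔰 then r else ∞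
  δ_singleton x := by simp
  δ_empty x := by simp
  δ_union A B x := by
    simp only [Set.mem_union, Set.preimage_union, Ultrafilter.union_mem_iff]
    by_cases h1 : x ∈ A <;> by_cases h2 : x ∈ B <;> by_cases h3 : x = none <;>
      by_cases h4 : some ⁻¹' A ∈ 𝔰 <;> by_cases h5 : some ⁻¹' B ∈ 𝔰 <;> simp_all
  δ_enlarge A x ε := by
    by_cases hε : ε = ∞
    · simp [hε]
    set A' := {y : Option S |
      (if y ∈ A then 0 else if y = none ∧ some ⁻¹' A ∈ 𝔰 then r else ∞) ≤ ε} with hA'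
    by_cases hx : x ∈ A'
    · exact le_add_left hx
    -- A finite enlargement can only add `none`, so the trace on `S` is unchanged.
    have hpre : some ⁻¹' A' = some ⁻¹' A := by
      ext s
      by_cases hs : some s ∈ A <;> simp [hA', hs, hε]
    have hxA : x ∉ A := fun h => hx (by simp [hA', h])
    rw [if_neg hx, if_neg hxA, hpre]
    exact le_self_add

theorem conv_onePoint_map_some_le (𝔰 : Ultrafilter S) (r : ℝ≥0∞) :
    @conv _ (onePoint 𝔰 r) (𝔰.map some) none ≤ r := by
  classical
  refine iSup₂_le fun A hA => ?_
  change (if none ∈ A then 0 else if none = none ∧ some ⁻¹' A ∈ 𝔰 then r else ∞) ≤ r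
  rw [if_pos (⟨rfl, hA⟩ : none = none ∧ some ⁻¹' A ∈ 𝔰)]
  split_ifs <;> simp

/-- Only two kinds of convergence in the first coordinate are finite: that of principal ultrafilters
to their own point, covered by `hf`, and that of `𝔰` to `none`, covered by `h𝔰`. At distance `∞`
nothing is claimed. -/
theorem isContraction_onePoint_prod (𝔰 : Ultrafilter S) (r : ℝ≥0∞)
    (f : Option S → X → ℝ≥0∞)
    (hf : ∀ z, IsContraction fun x => (ULift.up (f z x) : ULift.{w} ℝ≥0∞))
    (h𝔰 : ∀ 𝔴 : Ultrafilter (S × X), 𝔴.map Prod.fst = 𝔰 → ∀ x, ∀ A ∈ 𝔴,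
      f none x ≤ (r ⊔ conv (𝔴.map Prod.snd) x) + ⨆ p ∈ A, f (some p.1) p.2) :
    @IsContraction _ _ (@ApproachSpace.prod _ _ (onePoint 𝔰 r) _) _
      (fun p : Option S × X => (ULift.up (f p.1 p.2) : ULift.{w} ℝ≥0∞)) := by
  classical
  let _ := onePoint 𝔰 r
  have hδ : ∀ (A : Set (Option S)) z,
      δ A z = if z ∈ A then 0 else if z = none ∧ some ⁻¹' A ∈ 𝔰 then r else ∞ := fun _ _ => rfl
  refine isContraction_up_iff.2 fun 𝔴 ⟨z, x⟩ A hA => ?_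
  rw [conv_prod]
  by_cases hz : {z} ∈ 𝔴.map Prod.fst
  · have hB : {y | (z, y) ∈ A} ∈ 𝔴.map Prod.snd := by
      rw [Ultrafilter.mem_map] at hz ⊢
      filter_upwards [hz, hA] with p hp hpA
      obtain rfl : p.1 = z := hp
      exact hpA
    refine (isContraction_up_iff.1 (hf z) _ x _ hB).trans (add_le_add le_sup_right ?_)
    exact iSup₂_le fun y hy => le_iSup₂_of_le (f := fun p (_ : p ∈ A) => f p.1 p.2) (z, y) hy le_rfl
  have htop : ∀ B ∈ 𝔴.map Prod.fst, δ B z = ∞ → f z x ≤ (conv (𝔴.map Prod.fst) z ⊔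
      conv (𝔴.map Prod.snd) x) + ⨆ p ∈ A, f p.1 p.2 := by
    intro B hB h
    have htop : conv (𝔴.map Prod.fst) z = ∞ := top_unique (h ▸ δ_le_conv hB z)
    rw [htop]
    simp
  have hz' := Ultrafilter.compl_mem_iff_notMem.2 hz
  cases z with
  | some s => exact htop _ hz' (by rw [hδ]; simp)
  | none =>
    -- Since `{none}` is not in the first projection, `𝔴` comes from `S × X`.
    obtain ⟨𝔯, -, rfl⟩ := exists_ultrafilter_map_eq (Prod.map some id) 𝔴 (Q := Set.univ) (by
      filter_upwards [(Ultrafilter.mem_map.1 hz' : _ ∈ 𝔴)] with p hp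
      obtain ⟨_ | s, y⟩ := p
      · exact absurd rfl hp
      · exact ⟨(s, y), trivial, rfl⟩)
    by_cases h𝔯 : 𝔯.map Prod.fst = 𝔰
    · refine (h𝔰 𝔯 h𝔯 x _ hA).trans (add_le_add (sup_le_sup ?_ le_rfl) ?_)
      · refine le_trans ?_ (δ_le_conv hz' none)
        rw [hδ]
        simp
        split_ifs <;> simp
      · exact iSup₂_le fun p hp =>
          le_iSup₂_of_le (f := fun p (_ : p ∈ A) => f p.1 p.2) (some p.1, p.2) hp le_rfl
    · obtain ⟨B, hB, hB𝔰⟩ : ∃ B ∈ 𝔯.map Prod.fst, B ∉ 𝔰 := by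
        by_contra! hn
        exact h𝔯 (Ultrafilter.coe_le_coe.1 hn).symm
      refine htop (some '' B) ?_ ?_
      · rw [Ultrafilter.mem_map] at hB
        refine Ultrafilter.mem_map.2 (Ultrafilter.mem_map.2 ?_)
        filter_upwards [hB] with p hp
        exact ⟨p.1, hp, rfl⟩
      · rw [hδ, Set.preimage_image_eq _ (Option.some_injective S)]
        simp [hB𝔰]

end OnePoint

end ApproachSpace

/-! ### Necessity of the inequality. -/

namespace AppCat

variable {X : Type w} [ApproachSpace X]

/-- The uniqueness half matters: it identifies points of `E` with the functions they induce. -/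
theorem IsExponentiable.exists_eval (hX : IsExponentiable (of X)) (V : AppCat.{w}) :
    ∃ (E : AppCat.{w}) (ev : E.carrier × X → V.carrier), IsContraction ev ∧
      ∀ (Z : AppCat.{w}) (g : Z.carrier × X → V.carrier), IsContraction g →
        ∃! k : Z.carrier → E.carrier, IsContraction k ∧ ∀ z x, ev (k z, x) = g (z, x) := by
  obtain ⟨G, ⟨adj⟩⟩ := hX.exists_rightAdjoint
  refine ⟨G.obj V, (adj.counit.app V).toFun, (adj.counit.app V).contraction, fun Z g hg => ?_⟩
  let g' : (prodFunctor (of X)).obj Z ⟶ V := ⟨g, hg⟩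
  have hcounit : ∀ k : Z ⟶ G.obj V, ((adj.homEquiv Z V).symm k).toFun =
      fun p => (adj.counit.app V).toFun (k.toFun p.1, p.2) := by
    intro k
    rw [Adjunction.homEquiv_counit]
    rfl
  refine ⟨(adj.homEquiv Z V g').toFun, ⟨(adj.homEquiv Z V g').contraction, fun z x => ?_⟩, ?_⟩
  · have := congrFun (hcounit (adj.homEquiv Z V g')) (z, x)
    rw [Equiv.symm_apply_apply] at this
    exact this.symm
  · rintro k ⟨hk, hkg⟩
    let k' : Z ⟶ G.obj V := ⟨k, hk⟩
    have : (adj.homEquiv Z V).symm k' = g' :=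
      hom_ext fun p => (congrFun (hcounit k') p).trans (hkg p.1 p.2)
    rw [← this, Equiv.apply_symm_apply]

theorem IsExponentiable.iInf_le (hX : IsExponentiable (of X))
    (𝔛 : Ultrafilter (Ultrafilter X)) (x₀ : X) (u v : ℝ≥0∞) :
    ⨅ 𝔵 : Ultrafilter X, (u ⊔ conv 𝔵 x₀) + (v ⊔ ultraExt conv 𝔛 𝔵) ≤
      (u + v) ⊔ conv (ultraMul 𝔛) x₀ := by
  obtain ⟨E, ev, hev, huniv⟩ := hX.exists_eval (of (ULift.{w} ℝ≥0∞))
  have hpt : ∀ h : X → ℝ≥0∞, IsContraction (fun x => (ULift.up (h x) : ULift.{w} ℝ≥0∞)) →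
      ∃ e, ∀ x, ev (e, x) = ULift.up (h x) := by
    intro h hh
    obtain ⟨k, ⟨-, hk⟩, -⟩ := huniv (of X) (fun p => ULift.up (h p.2)) (hh.comp isContraction_snd)
    exact ⟨k x₀, hk x₀⟩
  have hinj : ∀ e e' : E.carrier, (∀ x, ev (e, x) = ev (e', x)) → e = e' := by
    intro e e' h
    have := (huniv (of X) (fun p => ev (e', p.2)) ((hev.curry e').comp isContraction_snd)).unique
      ⟨isContraction_const e, fun _ x => h x⟩ ⟨isContraction_const e', fun _ x => rfl⟩
    exact congrFun this x₀
  -- The transpose of a contraction on `onePoint 𝔰 r` times `X` is a contraction into `E`; it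
  -- carries the convergence of `𝔰` to `none` within `r` to the desired one.
  have hconv : ∀ (S : Type w) (𝔰 : Ultrafilter S) (r : ℝ≥0∞) (q : S → E.carrier)
      (e : E.carrier), (∀ 𝔴 : Ultrafilter (S × X), 𝔴.map Prod.fst = 𝔰 → ∀ x, ∀ A ∈ 𝔴,
        (ev (e, x)).down ≤ (r ⊔ conv (𝔴.map Prod.snd) x) + ⨆ p ∈ A, (ev (q p.1, p.2)).down) →
      conv (𝔰.map q) e ≤ r := by
    intro S 𝔰 r q e h
    let k : Option S → E.carrier := fun z => z.elim e q
    obtain ⟨k', ⟨hk', hkk'⟩, -⟩ := huniv (@of _ (onePoint 𝔰 r)) _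
      (isContraction_onePoint_prod 𝔰 r (fun z x => (ev (k z, x)).down)
        (fun z => hev.curry (k z)) h)
    obtain rfl : k' = k := funext fun z => hinj _ _ (hkk' z)
    have h1 := (@isContraction_iff_conv _ _ (onePoint 𝔰 r) _ _).1 hk' (𝔰.map some) none
    rw [Ultrafilter.map_map] at h1
    exact h1.trans (conv_onePoint_map_some_le 𝔰 r)
  choose q₂ hq₂ using fun x : X => hpt _ (isContraction_up_δ_singleton x)
  choose q₁ hq₁ using fun 𝔞 : Ultrafilter X => hpt _ (isContraction_up_sup_conv v 𝔞)
  obtain ⟨q₀, hq₀⟩ := hpt _ (isContraction_up_iInf 𝔛 u v)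
  have h₁ : ∀ 𝔞 : Ultrafilter X, conv (𝔞.map q₂) (q₁ 𝔞) ≤ v := by
    refine fun 𝔞 => hconv X 𝔞 v q₂ (q₁ 𝔞) ?_
    rintro 𝔴 rfl x A hA
    simp only [hq₁, hq₂]
    refine sup_le (le_add_right le_sup_left) ?_
    -- Writing the first marginal of `𝔴` as a product of principal ultrafilters lets transitivity
    -- compare it with the second marginal, at a cost bounded by the supremum of `δ {p.1} p.2` over
    -- `A`.
    have h := conv_ultraMul_le (𝔴.map fun p => (pure p.1 : Ultrafilter X)) (𝔴.map Prod.snd) x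
    have hm : ultraMul (𝔴.map fun p => (pure p.1 : Ultrafilter X)) = 𝔴.map Prod.fst :=
      Ultrafilter.ext fun _ => Iff.rfl
    rw [hm] at h
    refine h.trans (add_le_add le_sup_right (ultraExt_map_map_le 𝔴 _ _ hA fun p hp => ?_))
    rw [conv_pure_eq]
    exact le_iSup₂_of_le (f := fun (p : X × X) (_ : p ∈ A) => δ {p.1} p.2) p hp le_rfl
  have h₀ : conv (𝔛.map q₁) q₀ ≤ u := by
    refine hconv _ 𝔛 u q₁ q₀ ?_
    rintro 𝔴 rfl x A hA
    simp only [hq₀, hq₁]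
    -- The second marginal of `𝔴` is the competitor in the infimum.
    refine (_root_.iInf_le _ (𝔴.map Prod.snd)).trans (add_le_add_right (sup_le ?_ ?_) _)
    · obtain ⟨p, hp⟩ := 𝔴.nonempty_of_mem hA
      exact le_iSup₂_of_le p hp le_sup_left
    · exact ultraExt_map_map_le 𝔴 _ _ hA fun p hp => le_iSup₂_of_le p hp le_sup_right
  have h₂ : conv ((ultraMul 𝔛).map q₂) q₀ ≤ u + v := by
    rw [← ultraMul_map]
    exact (conv_ultraMul_le _ (𝔛.map q₁) q₀).trans (add_le_add h₀
      (ultraExt_map_map_le 𝔛 _ _ Filter.univ_mem fun 𝔞 _ => h₁ 𝔞))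
  -- Along this graph evaluation is `δ {x} x = 0`, so the supremum term vanishes.
  let d : X → E.carrier × X := fun x => (q₂ x, x)
  have h₃ := (isContraction_up_iff (f := fun p => (ev p).down)).1 hev ((ultraMul 𝔛).map d)
    (q₀, x₀) (Set.range d) Filter.range_mem_map
  have hzero : ⨆ p ∈ Set.range d, (ev p).down = 0 := by
    simp only [iSup_range, d, hq₂, δ_singleton, ENNReal.iSup_zero]
  rw [hzero, add_zero, hq₀, conv_prod, Ultrafilter.map_map, Ultrafilter.map_map] at h₃
  exact h₃.trans (sup_le_sup h₂ le_rfl)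

end AppCat

theorem theorem5p1 {X : Type*} [ApproachSpace X] :
    AppCat.IsExponentiable (AppCat.of X) ↔
      ∀ (𝔛 : Ultrafilter (Ultrafilter X)) (x₀ : X) (u v : ℝ≥0∞),
        (u + v) ⊔ ApproachSpace.conv (ApproachSpace.ultraMul 𝔛) x₀ ≥
          ⨅ 𝔵 : Ultrafilter X, (u ⊔ ApproachSpace.conv 𝔵 x₀) +
            (v ⊔ ApproachSpace.ultraExt ApproachSpace.conv 𝔛 𝔵) :=
  ⟨fun hX 𝔛 x₀ u v => hX.iInf_le 𝔛 x₀ u v, AppCat.isExponentiable_of_le⟩
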